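/- Let $(\Omega,\Sigma,\mathbb{P})$ be a probability space and let $L^0$ be the ordered lattice ring of real-valued $\Sigma$-measurable random variables modulo almost sure equality. For $\xi,\eta\in L^0$, write $\xi<\eta$ if $\xi<\eta$ almost surely on $\Omega$. Equip $L^0$ with the topology in which the sets $\{\xi : |\xi-\eta|\le\varepsilon\}$, with $\varepsilon\in L^0$, $\varepsilon>0$, form a neighborhood base of $\eta$. Let $\mathcal{F}$ be the measure algebra of $\mathbb{P}$ (events modulo null events), and let $p(\Omega)$ be the set of countable partitions of $\Omega$ in $\mathcal{F}$. Definitions. An $L^0$-module $E$ has the countable concatenation property if for all $\{A_k\}\in p(\Omega)$ and all sequences $\{x_k\}$ in $E$ there is a unique $x\in E$, denoted $\sum 1_{A_k}x_k$, with $1_{A_k}x=1_{A_k}x_k$ for every $k$. For such $E$: - A non-empty set $S\subset E$ is stable if $\sum 1_{A_k}x_k\in S$ for all $\{x_k\}\subset S$ and $\{A_k\}\in p(\Omega)$. A non-empty collection $\mathscr{C}$ of stable subsets of $E$ is stable if $\sum 1_{A_k}S_k:=\{\sum 1_{A_k}x_k : x_k\in S_k\}\in\mathscr{C}$ for all $\{S_k\}\subset\mathscr{C}$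 and $\{A_k\}\in p(\Omega)$. - $S\subset E$ is $L^0$-convex if $\eta x+(1-\eta)y\in S$ for all $x,y\in S$ and $\eta\in L^0$ with $0\le\eta\le1$. It is $L^0$-absorbing if for every $x\in E$ there is $\eta\in L^0$, $\eta>0$, with $x\in\eta S$. It is $L^0$-balanced if $\eta x\in S$ for all $x\in S$ and $\eta\in L^0$ with $|\eta|\le1$. - $E$ with a topology is a stable locally $L^0$-convex module if it has the countable concatenation property, the maps $E\times E\to E$, $(x,y)\mapsto x+y$, and $L^0\times E\to E$, $(\eta,x)\mapsto\eta x$, are continuous, and $0\in E$ has a neighborhood base that is a stable collection of $L^0$-convex, $L^0$-absorbing and $L^0$-balanced sets. - A stable set $S\subset E$ is stably compact if every filter base $\mathscr{B}$ of subsets of $S$ which is a stable collection has a cluster point in $S$, that is, there is $x\in S$ lying in the closure of every $B\in\mathscr{B}$. Theorem. Let $E$ be a stable locally $L^0$-convex module, and let $S_1,S_2\subset E$ be stable and $L^0$-convex, with $S_1$ stably compact and $S_2$ closed. If $$1_AS_1\cap1_AS_2=\emptyset\quad\text{for all }A\in\mathcal{F}\text{ with }A\neq\emptyset,$$ where $1_AS:=\{1_Ax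 : x\in S\}$, then there exist a continuous $L^0$-linear map $\mu:E\to L^0$ and $\varepsilon\in L^0$, $\varepsilon>0$, such that $$\mu(x)>\mu(y)+\varepsilon\quad\text{for all }x\in S_1,\ y\in S_2.$$ -/

import Mathlib

open MeasureTheory Set Filter Topology

universe u v

/-- `L⁰(Ω, Σ, P)`: real random variables modulo almost sure equality, with the pointwise algebraic
operations and the order of almost sure dominance provided by `AEEqFun`. -/
abbrev L0 {Ω : Type u} [MeasurableSpace Ω] (P : Measure Ω) : Type u := Ω →ₘ[P] ℝ

namespace L0

variable {Ω : Type u} [MeasurableSpace Ω] {P : Measure Ω}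

/-- The pointwise ring structure of `L⁰` (all operations are those of `AEEqFun`). -/
noncomputable instance instCommRing : CommRing (L0 P) :=
  { (inferInstance : AddCommGroup (Ω →ₘ[P] ℝ)), (inferInstance : CommMonoid (Ω →ₘ[P] ℝ)) with
    left_distrib := fun f g h => by
      induction f using AEEqFun.induction_on
      induction g using AEEqFun.induction_on
      induction h using AEEqFun.induction_on
      simp only [AEEqFun.mk_add_mk, AEEqFun.mk_mul_mk, mul_add]
    right_distrib := fun f g h => by
      induction f using AEEqFun.induction_on
      induction g using AEEqFun.induction_on
      induction h using AEEqFun.induction_on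
      simp only [AEEqFun.mk_add_mk, AEEqFun.mk_mul_mk, add_mul]
    zero_mul := fun f => by
      induction f using AEEqFun.induction_on
      rw [AEEqFun.zero_def, AEEqFun.mk_mul_mk]
      congr 1
      exact zero_mul _
    mul_zero := fun f => by
      induction f using AEEqFun.induction_on
      rw [AEEqFun.zero_def, AEEqFun.mk_mul_mk]
      congr 1
      exact mul_zero _ }

/-- The strict inequality of `L⁰`: `f < g` almost surely (on all of `Ω`).  This is stronger than
the strict part `f ≤ g ∧ f ≠ g` of the lattice order. -/
def StrictLT (f g : L0 P) : Prop := ∀ᵐ ω ∂P, f ω < g ω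

/-- The random variable `1_A`. -/
noncomputable def ind (P : Measure Ω) (A : Set Ω) (hA : MeasurableSet A) : L0 P :=
  AEEqFun.mk (A.indicator fun _ => (1 : ℝ))
    (stronglyMeasurable_const.indicator hA).aestronglyMeasurable

/-- The topology of almost sure dominance on `L⁰`: the balls `{g | |g - f| ≤ ε}`, where `ε` is an
almost surely strictly positive random variable, form a neighbourhood base of `f`. -/
instance instTopologicalSpace : TopologicalSpace (L0 P) where
  IsOpen s := ∀ f ∈ s, ∃ ε : L0 P, StrictLT 0 ε ∧ ∀ g : L0 P, |g - f| ≤ ε → g ∈ s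
  isOpen_univ := fun _ _ => ⟨1, by
    filter_upwards [AEEqFun.coeFn_zero (μ := P) (β := ℝ),
      AEEqFun.coeFn_one (μ := P) (β := ℝ)] with ω h0 h1
    rw [h0, h1]; simp, fun _ _ => trivial⟩
  isOpen_inter := fun s t hs ht f hf => by
    obtain ⟨ε, hε, hs'⟩ := hs f hf.1
    obtain ⟨δ, hδ, ht'⟩ := ht f hf.2
    refine ⟨ε ⊓ δ, ?_, fun g hg => ⟨hs' g (hg.trans inf_le_left), ht' g (hg.trans inf_le_right)⟩⟩
    filter_upwards [hε, hδ, AEEqFun.coeFn_inf ε δ] with ω h1 h2 h3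
    rw [h3]
    exact lt_inf_iff.2 ⟨h1, h2⟩
  isOpen_sUnion := fun S hS f ⟨s, hs, hf⟩ => by
    obtain ⟨ε, hε, h⟩ := hS s hs f hf
    exact ⟨ε, hε, fun g hg => ⟨s, hs, h g hg⟩⟩

end L0

section StableModules

variable {Ω : Type u} [MeasurableSpace Ω] (P : Measure Ω)

/-- A countable partition of `Ω` in the measure algebra of `P`, given through representatives.
Parts may be null, so finite partitions are included. -/
structure AEPartition where
  part : ℕ → Set Ω
  measurable : ∀ k, MeasurableSet (part k)
  disjoint : Pairwise fun i j => P (part i ∩ part j) = 0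
  cover : P (⋃ k, part k)ᶜ = 0

variable {P}

/-- The random variable `1_{A_k}` of the `k`-th part of a partition. -/
noncomputable def AEPartition.ind (A : AEPartition P) (k : ℕ) : L0 P :=
  L0.ind P (A.part k) (A.measurable k)

variable (P) {E : Type v} [AddCommGroup E] [Module (L0 P) E]

variable {P} in
/-- `z = ∑ 1_{A_k} x_k`, that is, `1_{A_k} z = 1_{A_k} x_k` for every `k`. -/
def IsConcat (A : AEPartition P) (x : ℕ → E) (z : E) : Prop :=
  ∀ k, A.ind k • z = A.ind k • x k

variable (E) in
/-- The countable concatenation property of an `L⁰`-module. -/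
def HasCountableConcat : Prop :=
  ∀ (A : AEPartition P) (x : ℕ → E), ∃! z : E, IsConcat A x z

variable {P} in
/-- `∑ 1_{A_k} S_k`, the set of all concatenations of points `x_k ∈ S_k`. -/
def concatSet (A : AEPartition P) (S : ℕ → Set E) : Set E :=
  {z | ∃ x : ℕ → E, (∀ k, x k ∈ S k) ∧ IsConcat A x z}

/-- Stable subsets: non-empty and closed under countable concatenations. -/
def IsStable (S : Set E) : Prop :=
  S.Nonempty ∧ ∀ (A : AEPartition P) (x : ℕ → E), (∀ k, x k ∈ S) → ∀ z, IsConcat A x z → z ∈ S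

/-- Stable collections of subsets. -/
def IsStableCollection (C : Set (Set E)) : Prop :=
  C.Nonempty ∧ (∀ S ∈ C, IsStable P S) ∧
    ∀ (A : AEPartition P) (S : ℕ → Set E), (∀ k, S k ∈ C) → concatSet A S ∈ C

/-- `L⁰`-convex subsets. -/
def IsL0Convex (S : Set E) : Prop :=
  ∀ x ∈ S, ∀ y ∈ S, ∀ η : L0 P, 0 ≤ η → η ≤ 1 → η • x + (1 - η) • y ∈ S

/-- `L⁰`-absorbing subsets: every `x` lies in `η S` for some `η > 0`. -/
def IsL0Absorbing (S : Set E) : Prop :=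
  ∀ x : E, ∃ η : L0 P, L0.StrictLT 0 η ∧ ∃ y ∈ S, x = η • y

/-- `L⁰`-balanced subsets. -/
def IsL0Balanced (S : Set E) : Prop :=
  ∀ x ∈ S, ∀ η : L0 P, |η| ≤ 1 → η • x ∈ S

variable [TopologicalSpace E]

variable (E) in
/-- Stable locally `L⁰`-convex modules: topological `L⁰`-modules (for the topology of almost sure
dominance on `L⁰`) with the countable concatenation property which have a neighbourhood base of `0`
that is a stable collection of `L⁰`-convex, `L⁰`-absorbing and `L⁰`-balanced sets. -/
structure IsStableLocallyL0Convex : Prop where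
  continuous_add : Continuous fun p : E × E => p.1 + p.2
  continuous_smul : Continuous fun p : L0 P × E => p.1 • p.2
  concat : HasCountableConcat P E
  exists_base : ∃ U : Set (Set E), (𝓝 (0 : E)).HasBasis (fun V => V ∈ U) (fun V => V) ∧
    IsStableCollection P U ∧
    ∀ V ∈ U, IsL0Convex P V ∧ IsL0Absorbing P V ∧ IsL0Balanced P V

/-- A stable filter base on `S`: a stable collection of (non-empty) subsets of `S` which is
directed downwards. -/
def IsStableFilterBaseOn (S : Set E) (B : Set (Set E)) : Prop :=
  IsStableCollection P B ∧ (∀ F ∈ B, F ⊆ S) ∧ ∀ F ∈ B, ∀ G ∈ B, ∃ H ∈ B, H ⊆ F ∩ G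

/-- Stably compact subsets: stable, and every stable filter base on `S` has a cluster point
in `S`. -/
def IsStablyCompact (S : Set E) : Prop :=
  IsStable P S ∧ ∀ B : Set (Set E), IsStableFilterBaseOn P S B → ∃ x ∈ S, ∀ F ∈ B, x ∈ closure F

end StableModules

/-! ### Order, indicators, exhaustion and Dedekind completeness in `L0` -/

namespace L0

variable {Ω : Type u} [MeasurableSpace Ω] {P : Measure Ω}

/-! Everything is reduced to separating `0` from `D = S₁ - S₂`, which is stable, `L⁰`-convex and, by
stable compactness of `S₁`, closed (`isClosed_sub`). The hypothesis says that no point of `D`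
vanishes on a non-null event.

Closedness yields only a neighbourhood disjoint from `D`, while separation needs one whose points
agree with points of `D` on no non-null event. `exists_nhds_ind_smul_ne` obtains it by exhaustion
over events, pasting neighbourhoods with the stability of the base.

Given such a `V`, the gauge of `V - D + d₀` is at least `1` at `d₀`. A linear map below the gauge
and attaining it at `d₀` is continuous and bounded below on `D` by a strictly positive element
(`exists_continuous_linearMap_le`). That map comes from a Hahn-Banach argument
(`exists_linearMap_le`) that finds a minimal sublinear map instead of extending from submodules, so
scalars without inverses do no harm; the infima it needs exist because `L0` is Dedekind complete. -/

instance instIsOrderedAddMonoid : IsOrderedAddMonoid (L0 P) where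
  add_le_add_left f g h k := by
    rw [← AEEqFun.coeFn_le] at h ⊢
    filter_upwards [h, AEEqFun.coeFn_add f k, AEEqFun.coeFn_add g k] with ω h1 h2 h3
    rw [h2, h3]
    exact add_le_add_left h1 _

theorem coeFn_ind {A : Set Ω} (hA : MeasurableSet A) :
    ind P A hA =ᵐ[P] A.indicator fun _ => (1 : ℝ) :=
  AEEqFun.coeFn_mk _ _

theorem strictLT_zero_iff {a : L0 P} : StrictLT 0 a ↔ ∀ᵐ ω ∂P, 0 < a ω := by
  constructor <;> intro h <;>
    filter_upwards [h, AEEqFun.coeFn_zero (μ := P) (β := ℝ)] with ω h1 h2 <;> simpa [h2] using h1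

theorem StrictLT.le {a b : L0 P} (h : StrictLT a b) : a ≤ b := by
  rw [← AEEqFun.coeFn_le]
  filter_upwards [h] with ω h1 using h1.le

theorem zero_strictLT_one : StrictLT (0 : L0 P) 1 := by
  rw [strictLT_zero_iff]
  filter_upwards [AEEqFun.coeFn_one (μ := P) (β := ℝ)] with ω h1
  simp [h1]

theorem StrictLT.add {a b : L0 P} (ha : StrictLT 0 a) (hb : StrictLT 0 b) :
    StrictLT 0 (a + b) := by
  rw [strictLT_zero_iff] at *
  filter_upwards [ha, hb, AEEqFun.coeFn_add a b] with ω h1 h2 h3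
  simpa [h3] using add_pos h1 h2

theorem StrictLT.mul {a b : L0 P} (ha : StrictLT 0 a) (hb : StrictLT 0 b) :
    StrictLT 0 (a * b) := by
  rw [strictLT_zero_iff] at *
  filter_upwards [ha, hb, AEEqFun.coeFn_mul a b] with ω h1 h2 h3
  simpa [h3] using mul_pos h1 h2

theorem StrictLT.exists_inv {a : L0 P} (ha : StrictLT 0 a) :
    ∃ b : L0 P, StrictLT 0 b ∧ a * b = 1 := by
  rw [strictLT_zero_iff] at ha
  have hb := AEEqFun.coeFn_compMeasurable (μ := P) (fun x : ℝ => x⁻¹) measurable_inv a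
  refine ⟨AEEqFun.compMeasurable (fun x : ℝ => x⁻¹) measurable_inv a, ?_, ?_⟩
  · rw [strictLT_zero_iff]
    filter_upwards [ha, hb] with ω h1 h2
    simpa [h2] using h1
  · apply AEEqFun.ext
    filter_upwards [ha, hb, AEEqFun.coeFn_mul a (AEEqFun.compMeasurable (fun x : ℝ => x⁻¹)
      measurable_inv a), AEEqFun.coeFn_one (μ := P) (β := ℝ)] with ω h1 h2 h3 h4
    rw [h3, h4, Pi.mul_apply, h2]
    simpa using mul_inv_cancel₀ h1.ne'

theorem mul_le_mul_of_nonneg {a b c : L0 P} (ha : 0 ≤ a) (h : b ≤ c) : a * b ≤ a * c := by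
  rw [← AEEqFun.coeFn_le] at *
  filter_upwards [ha, h, AEEqFun.coeFn_mul a b, AEEqFun.coeFn_mul a c,
    AEEqFun.coeFn_zero (μ := P) (β := ℝ)] with ω h1 h2 h3 h4 h5
  rw [h3, h4]
  rw [h5] at h1
  exact mul_le_mul_of_nonneg_left h2 h1

theorem abs_mul_le {a b c : L0 P} (ha : 0 ≤ a) (h : |b| ≤ c) : |a * b| ≤ a * c := by
  rw [abs_le'] at *
  exact ⟨mul_le_mul_of_nonneg ha h.1, by simpa using mul_le_mul_of_nonneg ha h.2⟩

theorem zero_strictLT_abs_add_one (a : L0 P) : StrictLT 0 (|a| + 1) := by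
  rw [strictLT_zero_iff]
  filter_upwards [AEEqFun.coeFn_add |a| 1, AEEqFun.coeFn_abs a,
    AEEqFun.coeFn_one (μ := P) (β := ℝ)] with ω h1 h2 h3
  rw [h1, Pi.add_apply, h2, h3]
  have := abs_nonneg (a ω)
  simp only [Pi.one_apply]
  linarith

theorem exists_strictLT_sub (a : L0 P) :
    ∃ b c : L0 P, StrictLT 0 b ∧ StrictLT 0 c ∧ a = b - c := by
  refine ⟨|a| + 1 + a, |a| + 1, ?_, zero_strictLT_abs_add_one a, by ring⟩
  rw [strictLT_zero_iff]
  filter_upwards [AEEqFun.coeFn_add (|a| + 1) a, AEEqFun.coeFn_add |a| 1, AEEqFun.coeFn_abs a,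
    AEEqFun.coeFn_one (μ := P) (β := ℝ)] with ω h0 h1 h2 h3
  rw [h0, Pi.add_apply, h1, Pi.add_apply, h2, h3]
  have := neg_abs_le (a ω)
  simp only [Pi.one_apply]
  linarith

theorem StrictLT.exists_half {a : L0 P} (ha : StrictLT 0 a) :
    ∃ b : L0 P, StrictLT 0 b ∧ StrictLT b a := by
  rw [strictLT_zero_iff] at ha
  refine ⟨(2⁻¹ : ℝ) • a, ?_, ?_⟩
  · rw [strictLT_zero_iff]
    filter_upwards [ha, AEEqFun.coeFn_smul (2⁻¹ : ℝ) a] with ω h1 h2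
    simpa [h2] using h1
  · filter_upwards [ha, AEEqFun.coeFn_smul (2⁻¹ : ℝ) a] with ω h1 h2
    rw [h2]
    simp only [Pi.smul_apply, smul_eq_mul]
    linarith

theorem ind_mul_ind {A B : Set Ω} (hA : MeasurableSet A) (hB : MeasurableSet B) :
    ind P A hA * ind P B hB = ind P (A ∩ B) (hA.inter hB) := by
  apply AEEqFun.ext
  filter_upwards [AEEqFun.coeFn_mul (ind P A hA) (ind P B hB), coeFn_ind (P := P) hA,
    coeFn_ind (P := P) hB, coeFn_ind (P := P) (hA.inter hB)] with ω h1 h2 h3 h4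
  rw [h1, Pi.mul_apply, h2, h3, h4]
  by_cases h : ω ∈ A <;> by_cases h' : ω ∈ B <;> simp [h, h']

theorem ind_mul_ind_of_subset {A B : Set Ω} (hA : MeasurableSet A) (hB : MeasurableSet B)
    (h : A ⊆ B) : ind P A hA * ind P B hB = ind P A hA := by
  rw [ind_mul_ind]
  congr 1
  exact inter_eq_left.2 h

theorem ind_congr {A B : Set Ω} (hA : MeasurableSet A) (hB : MeasurableSet B)
    (h : A =ᵐ[P] B) : ind P A hA = ind P B hB := by
  apply AEEqFun.ext
  refine (coeFn_ind hA).trans (EventuallyEq.trans ?_ (coeFn_ind hB).symm)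
  exact indicator_ae_eq_of_ae_eq_set h

theorem ind_eq_zero {A : Set Ω} (hA : MeasurableSet A) (h : P A = 0) : ind P A hA = 0 := by
  apply AEEqFun.ext
  filter_upwards [coeFn_ind (P := P) hA, AEEqFun.coeFn_zero (μ := P) (β := ℝ),
    measure_eq_zero_iff_ae_notMem.1 h] with ω h1 h2 h3
  rw [h1, h2]
  simp [h3]

theorem ind_add_ind_compl {A : Set Ω} (hA : MeasurableSet A) :
    ind P A hA + ind P Aᶜ hA.compl = 1 := by
  apply AEEqFun.ext
  filter_upwards [AEEqFun.coeFn_add (ind P A hA) (ind P Aᶜ hA.compl), coeFn_ind (P := P) hA,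
    coeFn_ind (P := P) hA.compl, AEEqFun.coeFn_one (μ := P) (β := ℝ)] with ω h1 h2 h3 h4
  rw [h1, Pi.add_apply, h2, h3, h4]
  by_cases h : ω ∈ A <;> simp [h]

theorem ind_mul_ind_of_disjoint {A B : Set Ω} (hA : MeasurableSet A) (hB : MeasurableSet B)
    (h : Disjoint A B) : ind P A hA * ind P B hB = 0 := by
  rw [ind_mul_ind]
  exact ind_eq_zero _ (by simp [h.inter_eq])

theorem measurableSet_lt (a : L0 P) (q : ℝ) : MeasurableSet {ω | a ω < q} :=
  a.measurable measurableSet_Iio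

/-- Exhaustion: a property of events that passes to countable unions holds for a largest event. -/
theorem exists_measurableSet_maximal [IsFiniteMeasure P] (C : Set Ω → Prop) (h0 : C ∅)
    (hC : ∀ A : ℕ → Set Ω, (∀ n, MeasurableSet (A n)) → (∀ n, C (A n)) → C (⋃ n, A n)) :
    ∃ A, MeasurableSet A ∧ C A ∧ ∀ B, MeasurableSet B → C B → P (B \ A) = 0 := by
  set T : Set ENNReal := P '' {A | MeasurableSet A ∧ C A}
  have hT : T.Nonempty := ⟨_, ∅, ⟨MeasurableSet.empty, h0⟩, rfl⟩
  obtain ⟨u, -, hu, huT⟩ := exists_seq_tendsto_sSup hT (OrderTop.bddAbove T)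
  choose A hA hAu using huT
  have hm : MeasurableSet (⋃ n, A n) := .iUnion fun n => (hA n).1
  have hCA : C (⋃ n, A n) := hC A (fun n => (hA n).1) fun n => (hA n).2
  refine ⟨⋃ n, A n, hm, hCA, fun B hB hCB => ?_⟩
  have h1 : sSup T ≤ P (⋃ n, A n) :=
    le_of_tendsto' hu fun n => (hAu n) ▸ measure_mono (subset_iUnion A n)
  have h2 : P (B ∪ ⋃ n, A n) ≤ sSup T := by
    refine le_sSup ⟨_, ⟨hB.union hm, ?_⟩, rfl⟩
    -- `B` is put in front of the maximizing sequence, so `B ∪ ⋃ n, A n` is again a competitor for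
    -- the supremum.
    have := hC (fun n => Nat.casesOn n B fun n => A n)
      (fun n => by cases n <;> simp [hB, (hA _).1]) (fun n => by cases n <;> simp [hCB, (hA _).2])
    convert this using 1
    ext ω
    simp only [mem_union, mem_iUnion]
    constructor
    · rintro (h | ⟨n, h⟩)
      exacts [⟨0, h⟩, ⟨n + 1, h⟩]
    · rintro ⟨_ | n, h⟩
      exacts [.inl h, .inr ⟨n, h⟩]
  have h3 : P (B \ ⋃ n, A n) + P (⋃ n, A n) ≤ 0 + P (⋃ n, A n) := by
    rw [← measure_union disjoint_sdiff_left hm, sdiff_union_self, zero_add]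
    exact h2.trans h1
  exact nonpos_iff_eq_zero.1 (ENNReal.le_of_add_le_add_right (measure_ne_top _ _) h3)

/-- `L⁰` is Dedekind complete. -/
theorem exists_isGLB [IsFiniteMeasure P] {S : Set (L0 P)} (hne : S.Nonempty) (hbd : BddBelow S) :
    ∃ h, IsGLB S h := by
  -- For each rational level, countably many members of `S` have sublevel sets covering, up to null
  -- sets, that of any member. The pointwise infimum over all levels is then the greatest lower
  -- bound.
  have key : ∀ q : ℚ, ∃ g : ℕ → L0 P, (∀ n, g n ∈ S) ∧
      ∀ f ∈ S, P ({ω | f ω < q} \ ⋃ n, {ω | g n ω < q}) = 0 := by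
    intro q
    obtain ⟨A, -, hA, hmax⟩ := exists_measurableSet_maximal (P := P)
      (fun A => ∃ g : ℕ → L0 P, (∀ n, g n ∈ S) ∧ A ⊆ ⋃ n, {ω | g n ω < q})
      ⟨fun _ => hne.some, fun _ => hne.some_mem, empty_subset _⟩ (by
        intro A _ hA
        choose g hg hAg using hA
        refine ⟨fun k => g k.unpair.1 k.unpair.2, fun k => hg _ _, iUnion_subset fun n ω hω => ?_⟩
        obtain ⟨m, hm⟩ := mem_iUnion.1 (hAg n hω)
        exact mem_iUnion.2 ⟨Nat.pair n m, by simpa using hm⟩)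
    obtain ⟨g, hg, hAg⟩ := hA
    refine ⟨g, hg, fun f hf => measure_mono_null (sdiff_subset_sdiff_right hAg) ?_⟩
    exact hmax _ (measurableSet_lt f q) ⟨fun _ => f, fun _ => hf, fun ω hω => mem_iUnion.2 ⟨0, hω⟩⟩
  choose g hg hmax using key
  obtain ⟨b, hb⟩ := hbd
  have hbg : ∀ᵐ ω ∂P, ∀ i : ℚ × ℕ, b ω ≤ g i.1 i.2 ω :=
    ae_all_iff.2 fun i => AEEqFun.coeFn_le.2 (hb (hg i.1 i.2))
  have hmeas : AEMeasurable (fun ω => ⨅ i : ℚ × ℕ, g i.1 i.2 ω) P :=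
    AEMeasurable.iInf fun i => (g i.1 i.2).aemeasurable
  refine ⟨AEEqFun.mk _ hmeas.aestronglyMeasurable, fun f hf => ?_, fun c hc => ?_⟩
  · rw [← AEEqFun.coeFn_le]
    have hq : ∀ᵐ ω ∂P, ∀ q : ℚ, ω ∉ {ω | f ω < q} \ ⋃ n, {ω | g q n ω < q} :=
      ae_all_iff.2 fun q => measure_eq_zero_iff_ae_notMem.1 (hmax q f hf)
    filter_upwards [hq, hbg, AEEqFun.coeFn_mk _ hmeas.aestronglyMeasurable] with ω h1 h2 h3
    rw [h3]
    by_contra! hlt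
    obtain ⟨q, hq1, hq2⟩ := exists_rat_btwn hlt
    have h4 := h1 q
    simp only [Set.mem_sdiff, mem_ofPred_eq, hq1, true_and, not_not, mem_iUnion] at h4
    obtain ⟨n, hn⟩ := h4
    have h5 : ⨅ i : ℚ × ℕ, g i.1 i.2 ω ≤ g q n ω :=
      ciInf_le ⟨b ω, by rintro _ ⟨i, rfl⟩; exact h2 i⟩ (q, n)
    linarith
  · rw [← AEEqFun.coeFn_le]
    have hcg : ∀ᵐ ω ∂P, ∀ i : ℚ × ℕ, c ω ≤ g i.1 i.2 ω :=
      ae_all_iff.2 fun i => AEEqFun.coeFn_le.2 (hc (hg i.1 i.2))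
    filter_upwards [hcg, AEEqFun.coeFn_mk _ hmeas.aestronglyMeasurable] with ω h1 h2
    rw [h2]
    exact le_ciInf h1

end L0

/-! ### Sublinear maps and a Hahn-Banach theorem over `L0` -/

section HahnBanach

variable {Ω : Type u} [MeasurableSpace Ω] {P : Measure Ω} {E : Type v} [AddCommGroup E]
  [Module (L0 P) E]

/-- `L⁰`-sublinear maps `E → L⁰`. -/
structure IsL0Sublinear (p : E → L0 P) : Prop where
  add_le : ∀ x y, p (x + y) ≤ p x + p y
  smul_le : ∀ a : L0 P, L0.StrictLT 0 a → ∀ x, p (a • x) ≤ a * p x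

theorem IsL0Sublinear.smul_eq {p : E → L0 P} (hp : IsL0Sublinear p) {a : L0 P}
    (ha : L0.StrictLT 0 a) (x : E) : p (a • x) = a * p x := by
  refine le_antisymm (hp.smul_le a ha x) ?_
  obtain ⟨b, hb, hab⟩ := ha.exists_inv
  have h := L0.mul_le_mul_of_nonneg ha.le (hp.smul_le b hb (a • x))
  rwa [smul_smul, mul_comm b a, hab, one_smul, ← mul_assoc, hab, one_mul] at h

/-- Supplies the lower bound for the infimum along a chain of sublinear maps below `p`. -/
theorem IsL0Sublinear.neg_le {p : E → L0 P} (hp : IsL0Sublinear p) (x : E) : -p (-x) ≤ p x := by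
  have h0 : 0 ≤ p 0 := by
    have := hp.add_le 0 0
    rw [add_zero] at this
    exact le_add_iff_nonneg_right _ |>.1 this
  have h := hp.add_le x (-x)
  rw [add_neg_cancel] at h
  exact neg_le_iff_add_nonneg.2 (h0.trans h)

/-- Common source of sublinearity for the perturbed map, for infima of chains and for the gauge.
Homogeneity passes to the infimum because strictly positive scalars are invertible. -/
theorem isL0Sublinear_of_isGLB {S : E → Set (L0 P)} {q : E → L0 P} (hq : ∀ x, IsGLB (S x) (q x))
    (hadd : ∀ x y, ∀ s ∈ S x, ∀ t ∈ S y, ∃ r ∈ S (x + y), r ≤ s + t)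
    (hsmul : ∀ a : L0 P, L0.StrictLT 0 a → ∀ x, ∀ s ∈ S x, ∃ r ∈ S (a • x), r ≤ a * s) :
    IsL0Sublinear q where
  add_le x y := by
    rw [← sub_le_iff_le_add]
    refine (hq x).2 fun s hs => ?_
    rw [sub_le_comm]
    refine (hq y).2 fun t ht => ?_
    obtain ⟨r, hr, hrs⟩ := hadd x y s hs t ht
    rw [sub_le_iff_le_add']
    exact ((hq _).1 hr).trans hrs
  smul_le a ha x := by
    obtain ⟨b, hb, hab⟩ := ha.exists_inv
    have h : b * q (a • x) ≤ q x := (hq x).2 fun s hs => by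
      obtain ⟨r, hr, hrs⟩ := hsmul a ha x s hs
      have := L0.mul_le_mul_of_nonneg hb.le (((hq _).1 hr).trans hrs)
      rwa [← mul_assoc, mul_comm b a, hab, one_mul] at this
    have := L0.mul_le_mul_of_nonneg ha.le h
    rwa [← mul_assoc, hab, one_mul] at this

variable [IsFiniteMeasure P]

/-- The sublinear map `x ↦ inf_{t > 0} (p (x + t y) - t p y)`. -/
theorem IsL0Sublinear.exists_le_sub {p : E → L0 P} (hp : IsL0Sublinear p) (y : E) :
    ∃ q : E → L0 P, IsL0Sublinear q ∧ q ≤ p ∧ ∀ x, q x ≤ p (x + y) - p y := by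
  set S : E → Set (L0 P) := fun x =>
    {s | ∃ t : L0 P, L0.StrictLT 0 t ∧ s = p (x + t • y) - t * p y}
  have hS : ∀ x, ∃ h, IsGLB (S x) h := by
    refine fun x => L0.exists_isGLB ⟨_, 1, L0.zero_strictLT_one, rfl⟩ ⟨-p (-x), ?_⟩
    rintro _ ⟨t, ht, rfl⟩
    rw [le_sub_iff_add_le, neg_add_le_iff_le_add, ← hp.smul_eq ht]
    convert hp.add_le (-x) (x + t • y) using 2
    abel
  choose q hq using hS
  refine ⟨q, isL0Sublinear_of_isGLB hq ?_ ?_, fun x => ?_, fun x => ?_⟩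
  · rintro x x' _ ⟨t, ht, rfl⟩ _ ⟨t', ht', rfl⟩
    refine ⟨_, ⟨t + t', ht.add ht', rfl⟩, ?_⟩
    have h := hp.add_le (x + t • y) (x' + t' • y)
    rw [show x + t • y + (x' + t' • y) = x + x' + (t + t') • y by rw [add_smul]; abel] at h
    refine (sub_le_sub_right h _).trans_eq (by ring)
  · rintro a ha x _ ⟨t, ht, rfl⟩
    refine ⟨_, ⟨a * t, ha.mul ht, rfl⟩, ?_⟩
    rw [mul_smul, ← smul_add, hp.smul_eq ha, mul_sub, mul_assoc]
  · refine ((hq x).1 ⟨1, L0.zero_strictLT_one, rfl⟩).trans ?_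
    rw [one_smul, one_mul, sub_le_iff_le_add]
    exact hp.add_le x y
  · exact (hq x).1 ⟨1, L0.zero_strictLT_one, by rw [one_smul, one_mul]⟩

/-- A minimal sublinear map `q` is additive: `exists_le_sub` gives a sublinear `r ≤ q` with `r x ≤ q
(x + y) - q y`, and minimality forces `q ≤ r`. Zorn's lemma is applied in the order dual to get a
minimal element. -/
theorem IsL0Sublinear.exists_linearMap_le {p : E → L0 P} (hp : IsL0Sublinear p) :
    ∃ f : E →ₗ[L0 P] L0 P, ∀ x, f x ≤ p x := by
  obtain ⟨m, hm⟩ := zorn_le₀ (α := (E → L0 P)ᵒᵈ) {q | IsL0Sublinear (OrderDual.ofDual q) ∧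
      OrderDual.ofDual q ≤ p} (by
    intro c hc hchain
    obtain rfl | hne := c.eq_empty_or_nonempty
    · exact ⟨OrderDual.toDual p, ⟨hp, le_rfl⟩, by simp⟩
    set S : E → Set (L0 P) := fun x => {s | ∃ g ∈ c, s = OrderDual.ofDual g x}
    have hS : ∀ x, ∃ h, IsGLB (S x) h := by
      refine fun x => L0.exists_isGLB ⟨_, hne.some, hne.some_mem, rfl⟩ ⟨-p (-x), ?_⟩
      rintro _ ⟨g, hg, rfl⟩
      exact (neg_le_neg ((hc hg).2 (-x))).trans ((hc hg).1.neg_le x)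
    choose q hq using hS
    refine ⟨OrderDual.toDual q, ⟨isL0Sublinear_of_isGLB hq ?_ ?_, fun x => ?_⟩, fun g hg x => ?_⟩
    · rintro x y _ ⟨g, hg, rfl⟩ _ ⟨g', hg', rfl⟩
      obtain h | h := hchain.total hg hg'
      · exact ⟨_, ⟨g', hg', rfl⟩, ((hc hg').1.add_le x y).trans (add_le_add_left (h x) _)⟩
      · exact ⟨_, ⟨g, hg, rfl⟩, ((hc hg).1.add_le x y).trans (add_le_add_right (h y) _)⟩
    · rintro a ha x _ ⟨g, hg, rfl⟩
      exact ⟨_, ⟨g, hg, rfl⟩, (hc hg).1.smul_le a ha x⟩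
    · exact ((hq x).1 ⟨hne.some, hne.some_mem, rfl⟩).trans ((hc hne.some_mem).2 x)
    · exact (hq x).1 ⟨g, hg, rfl⟩)
  obtain ⟨q, rfl⟩ := OrderDual.toDual.surjective m
  have hq : IsL0Sublinear q := hm.prop.1
  have hadd : ∀ x y, q (x + y) = q x + q y := by
    intro x y
    refine le_antisymm (hq.add_le x y) ?_
    obtain ⟨r, hr, hrq, hry⟩ := hq.exists_le_sub y
    have h : q ≤ r := hm.le_of_ge (y := OrderDual.toDual r) ⟨hr, hrq.trans hm.prop.2⟩ hrq
    exact le_sub_iff_add_le.1 ((h x).trans (hry x))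
  let F : E →+ L0 P := AddMonoidHom.mk' q hadd
  refine ⟨{ F with map_smul' := fun a x => ?_ }, hm.prop.2⟩
  -- Homogeneity is known only for strictly positive scalars; every scalar is a difference of two of
  -- them.
  obtain ⟨b, c, hb, hc, rfl⟩ := L0.exists_strictLT_sub a
  change F ((b - c) • x) = (b - c) * F x
  rw [sub_smul, map_sub, sub_mul]
  exact congrArg₂ (· - ·) (hq.smul_eq hb x) (hq.smul_eq hc x)

/-- A sublinear map is attained at any given point by a linear map below it. -/
theorem IsL0Sublinear.exists_linearMap_le_eq {p : E → L0 P} (hp : IsL0Sublinear p) (y : E) :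
    ∃ f : E →ₗ[L0 P] L0 P, (∀ x, f x ≤ p x) ∧ p y ≤ f y := by
  obtain ⟨q, hq, hqp, hqy⟩ := hp.exists_le_sub y
  obtain ⟨f, hf⟩ := hq.exists_linearMap_le
  refine ⟨f, fun x => (hf x).trans (hqp x), ?_⟩
  -- At `-y` the bound reads `f (-y) ≤ p 0 - p y`, and `p 0 = 0`.
  have h := (hf (-y)).trans (hqy (-y))
  have h0 : p 0 = 0 := by
    have h1 := hp.smul_eq (L0.zero_strictLT_one.add L0.zero_strictLT_one) 0
    rwa [smul_zero, add_mul, one_mul, left_eq_add] at h1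
  rwa [map_neg, neg_add_cancel, h0, zero_sub, neg_le_neg_iff] at h

end HahnBanach

/-! ### Gluing along events, and neighbourhoods avoiding a closed stable set -/

section Concatenation

variable {Ω : Type u} [MeasurableSpace Ω] {P : Measure Ω} {E : Type v} [AddCommGroup E]
  [Module (L0 P) E]

theorem ind_smul_congr_of_subset {A B : Set Ω} (hA : MeasurableSet A) (hB : MeasurableSet B)
    (h : A ⊆ B) {x y : E} (hxy : L0.ind P B hB • x = L0.ind P B hB • y) :
    L0.ind P A hA • x = L0.ind P A hA • y := by
  rw [← L0.ind_mul_ind_of_subset hA hB h, mul_smul, mul_smul, hxy]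

theorem ind_smul_glue_left {A B : Set Ω} (hA : MeasurableSet A) (hB : MeasurableSet B)
    (h : A ⊆ B) (x y : E) :
    L0.ind P A hA • (L0.ind P B hB • x + L0.ind P Bᶜ hB.compl • y) = L0.ind P A hA • x := by
  rw [smul_add, smul_smul, smul_smul, L0.ind_mul_ind_of_subset hA hB h,
    L0.ind_mul_ind_of_disjoint _ _ (disjoint_compl_right_iff_subset.2 h), zero_smul, add_zero]

theorem ind_smul_glue_right {A B : Set Ω} (hA : MeasurableSet A) (hB : MeasurableSet B)
    (h : A ⊆ Bᶜ) (x y : E) :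
    L0.ind P A hA • (L0.ind P B hB • x + L0.ind P Bᶜ hB.compl • y) = L0.ind P A hA • y := by
  rw [smul_add, smul_smul, smul_smul, L0.ind_mul_ind_of_subset hA hB.compl h,
    L0.ind_mul_ind_of_disjoint _ _ (subset_compl_iff_disjoint_right.1 h), zero_smul, zero_add]

variable (P) in
/-- The partition into the complement of `⋃ n, A n` and the differences `A n \ ⋃ i < n, A i`. -/
def AEPartition.ofSeq (A : ℕ → Set Ω) (hA : ∀ n, MeasurableSet (A n)) : AEPartition P where
  part := fun k => Nat.casesOn k (⋃ n, A n)ᶜ (disjointed A)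
  measurable := by
    rintro (_ | k)
    exacts [(MeasurableSet.iUnion hA).compl, .disjointed hA k]
  disjoint := by
    have h : ∀ k, disjointed A k ∩ (⋃ n, A n)ᶜ = ∅ := fun k =>
      (disjoint_compl_right_iff_subset.2
        ((disjointed_le A k).trans (subset_iUnion A k))).inter_eq
    rintro (_ | i) (_ | j) hij
    · exact absurd rfl hij
    · change P ((⋃ n, A n)ᶜ ∩ disjointed A j) = 0
      rw [inter_comm, h, measure_empty]
    · change P (disjointed A i ∩ (⋃ n, A n)ᶜ) = 0
      rw [h, measure_empty]
    · change P (disjointed A i ∩ disjointed A j) = 0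
      rw [(disjoint_disjointed A (fun e => hij (congrArg _ e))).inter_eq, measure_empty]
  cover := by
    convert measure_empty (μ := P)
    refine compl_empty_iff.2 (eq_univ_of_forall fun ω => ?_)
    by_cases h : ω ∈ ⋃ n, A n
    · rw [← iUnion_disjointed] at h
      obtain ⟨n, hn⟩ := mem_iUnion.1 h
      exact mem_iUnion.2 ⟨n + 1, hn⟩
    · exact mem_iUnion.2 ⟨0, h⟩

theorem AEPartition.ofSeq_ind_zero (A : ℕ → Set Ω) (hA : ∀ n, MeasurableSet (A n)) :
    (AEPartition.ofSeq P A hA).ind 0 = L0.ind P (⋃ n, A n)ᶜ (MeasurableSet.iUnion hA).compl :=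
  rfl

theorem AEPartition.ofSeq_ind_succ (A : ℕ → Set Ω) (hA : ∀ n, MeasurableSet (A n)) (n : ℕ) :
    (AEPartition.ofSeq P A hA).ind (n + 1) = L0.ind P (disjointed A n) (.disjointed hA n) :=
  rfl

/-- Events on whose union two points agree as soon as they agree on each of them. -/
theorem HasCountableConcat.ind_smul_ext (hE : HasCountableConcat P E) {A : ℕ → Set Ω}
    (hA : ∀ n, MeasurableSet (A n)) {B : Set Ω} (hB : MeasurableSet B) (hBA : B ⊆ ⋃ n, A n)
    {x y : E} (h : ∀ n, L0.ind P (A n) (hA n) • x = L0.ind P (A n) (hA n) • y) :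
    L0.ind P B hB • x = L0.ind P B hB • y := by
  -- Both sides concatenate the same constant sequence; on part `0`, the complement of the union,
  -- both vanish.
  refine (hE (.ofSeq P A hA) fun _ => L0.ind P B hB • y).unique ?_ fun _ => rfl
  rintro (_ | k)
  · rw [AEPartition.ofSeq_ind_zero, smul_smul, smul_smul, L0.ind_mul_ind_of_disjoint _ _
      (subset_compl_iff_disjoint_left.1 (by rwa [compl_compl])), zero_smul, zero_smul]
  · rw [AEPartition.ofSeq_ind_succ, smul_comm, smul_comm _ (L0.ind P B hB),
      ind_smul_congr_of_subset _ (hA k)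
      (disjointed_le A k) (h k)]

theorem HasCountableConcat.exists_mem_of_seq (hE : HasCountableConcat P E) {A : ℕ → Set Ω}
    (hA : ∀ n, MeasurableSet (A n)) {S : Set E} (hS : IsStable P S) {x : ℕ → E}
    (hx : ∀ n, x n ∈ S) : ∃ z ∈ S, ∀ n, L0.ind P (disjointed A n) (.disjointed hA n) • z =
      L0.ind P (disjointed A n) (.disjointed hA n) • x n := by
  -- Part `n + 1` is `disjointed A n`, hence the shift; the value on part `0` is irrelevant.
  obtain ⟨z, hz, -⟩ := hE (.ofSeq P A hA) fun k => x (k - 1)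
  exact ⟨z, hS.2 _ _ (fun k => hx _) z hz, fun n => hz (n + 1)⟩

theorem IsStable.glue_mem {S : Set E} (hS : IsStable P S) {B : Set Ω} (hB : MeasurableSet B)
    {x y : E} (hx : x ∈ S) (hy : y ∈ S) :
    L0.ind P B hB • x + L0.ind P Bᶜ hB.compl • y ∈ S := by
  refine hS.2 (.ofSeq P (fun _ => B) fun _ => hB) (fun k => Nat.casesOn k y fun _ => x)
    (by rintro (_ | k) <;> assumption) _ ?_
  rintro (_ | k)
  · exact ind_smul_glue_right _ _ (by simp [AEPartition.ofSeq, iUnion_const]) _ _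
  · exact ind_smul_glue_left _ _ (disjointed_le (fun _ => B) k) _ _

variable [TopologicalSpace E]

/-- A closed stable set which omits `0` on every event is omitted on every event by some
neighbourhood of `0`. -/
theorem IsStableLocallyL0Convex.exists_nhds_ind_smul_ne [IsFiniteMeasure P]
    (hE : IsStableLocallyL0Convex P E) {U : Set (Set E)}
    (hU : (𝓝 (0 : E)).HasBasis (fun V => V ∈ U) fun V => V) (hUs : IsStableCollection P U)
    {D : Set E} (hD : IsStable P D) (hDc : IsClosed D)
    (h0 : ∀ A (hA : MeasurableSet A), ∀ d ∈ D, L0.ind P A hA • d = 0 → P A = 0) :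
    ∃ V ∈ U, ∀ A (hA : MeasurableSet A), ∀ v ∈ V, ∀ d ∈ D,
      L0.ind P A hA • v = L0.ind P A hA • d → P A = 0 := by
  obtain ⟨A, hA, ⟨V, hV, hVA⟩, hmax⟩ := L0.exists_measurableSet_maximal (P := P)
    (fun A => ∃ V ∈ U, ∀ B (hB : MeasurableSet B), B ⊆ A → ∀ v ∈ V, ∀ d ∈ D,
      L0.ind P B hB • v = L0.ind P B hB • d → P B = 0)
    (by
      obtain ⟨V, hV⟩ := hUs.1
      exact ⟨V, hV, fun B _ hBA _ _ _ _ _ => measure_mono_null hBA measure_empty⟩)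
    (by
      intro A hA h
      choose V hV hVA using h
      -- Stability of the base makes the pasted neighbourhood a member of `U`, so the property
      -- passes to countable unions.
      refine ⟨_, hUs.2.2 (.ofSeq P A hA) (fun k => V (k - 1)) fun k => hV _, ?_⟩
      rintro B hB hBA v ⟨w, hw, hvw⟩ d hd hvd
      have hB' : ⋃ n, B ∩ disjointed A n = B := by
        rw [← inter_iUnion, iUnion_disjointed, inter_eq_left.2 hBA]
      rw [← hB']
      refine measure_iUnion_null fun n => ?_
      have hm : MeasurableSet (B ∩ disjointed A n) := hB.inter (.disjointed hA n)
      refine hVA n _ hm (inter_subset_right.trans (disjointed_le A n)) _ (hw (n + 1)) d hd ?_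
      rw [← ind_smul_congr_of_subset hm _ inter_subset_right (hvw (n + 1)),
        ind_smul_congr_of_subset hm hB inter_subset_left hvd])
  refine ⟨V, hV, fun B hB v hv d hd hvd => ?_⟩
  suffices hAc : P Aᶜ = 0 by
    have h1 := hVA (B ∩ A) (hB.inter hA) inter_subset_right v hv d hd
      (ind_smul_congr_of_subset _ hB inter_subset_left hvd)
    refine measure_mono_null (fun ω hω => ?_) (measure_union_null h1 hAc)
    by_cases h : ω ∈ A
    exacts [.inl ⟨hω, h⟩, .inr h]
  clear hvd hd d hv v hB B
  by_contra hAc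
  obtain ⟨d₀, hd₀⟩ := hD.1
  -- If `Aᶜ` is not null, `y` lies outside `D` because it vanishes on `Aᶜ`; as `D` is closed, some
  -- `y + W` misses `D`.
  set y : E := L0.ind P A hA • d₀ with hy
  have hy0 : ∀ B (hB : MeasurableSet B), B ⊆ Aᶜ → L0.ind P B hB • y = 0 := fun B hB h => by
    rw [hy, smul_smul, L0.ind_mul_ind_of_disjoint _ _ (subset_compl_iff_disjoint_right.1 h),
      zero_smul]
  have hyD : y ∉ D := fun h => hAc (h0 _ hA.compl _ h (hy0 _ _ Subset.rfl))
  obtain ⟨W, hW, hWD⟩ : ∃ W ∈ U, ∀ w ∈ W, y + w ∉ D := by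
    have hc : ContinuousAt (fun w : E => y + w) 0 :=
      (hE.continuous_add.comp (Continuous.prodMk_right y)).continuousAt
    obtain ⟨W, hW, h⟩ := hU.mem_iff.1 (hc.preimage_mem_nhds
      (hDc.isOpen_compl.mem_nhds (by simpa using hyD)))
    exact ⟨W, hW, fun w hw => h hw⟩
  have hWs := hUs.2.1 W hW
  have hW0 : (0 : E) ∈ W := mem_of_mem_nhds (hU.mem_of_mem hW)
  -- A second exhaustion: a largest event on which some point of `y + W` agrees with a point of `D`.
  obtain ⟨B, hB, ⟨w, hw, d, hd, hwd⟩, hBmax⟩ := L0.exists_measurableSet_maximal (P := P)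
    (fun B => ∃ w ∈ W, ∃ d ∈ D, ∀ C (hC : MeasurableSet C), C ⊆ B →
      L0.ind P C hC • (y + w) = L0.ind P C hC • d)
    (by
      refine ⟨0, hW0, d₀, hd₀, fun C hC h => ?_⟩
      rw [L0.ind_eq_zero hC (measure_mono_null h measure_empty), zero_smul, zero_smul])
    (by
      intro B hB h
      choose w hw d hd hwd using h
      obtain ⟨w', hw', hww'⟩ := hE.concat.exists_mem_of_seq hB hWs hw
      obtain ⟨d', hd', hdd'⟩ := hE.concat.exists_mem_of_seq hB hD hd
      refine ⟨w', hw', d', hd', fun C hC hCB => ?_⟩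
      refine hE.concat.ind_smul_ext (.disjointed hB) hC (by rwa [iUnion_disjointed]) fun n => ?_
      rw [hdd', smul_add, hww', ← smul_add]
      exact hwd n _ _ (disjointed_le B n))
  have hCB : P (Aᶜ \ B) ≠ 0 := by
    intro hnull
    -- If `Aᶜ ⊆ B` up to a null set, then `y = d₀` on `Bᶜ`. Cutting `w` to `0` there puts a point of
    -- `y + W` in `D`.
    refine hWD _ (hWs.glue_mem hB hw hW0) ?_
    have hsub : L0.ind P Bᶜ hB.compl * L0.ind P A hA = L0.ind P Bᶜ hB.compl := by
      rw [L0.ind_mul_ind]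
      refine L0.ind_congr _ _ (ae_eq_set.2 ⟨?_, measure_mono_null (fun ω hω => ?_) hnull⟩)
      · rw [sdiff_eq_empty.2 inter_subset_left, measure_empty]
      · exact ⟨fun h => hω.2 ⟨hω.1, h⟩, hω.1⟩
    convert hD.glue_mem hB hd hd₀ using 1
    nth_rw 1 [← one_smul (L0 P) y]
    rw [← L0.ind_add_ind_compl hB, add_smul, ← hwd B hB Subset.rfl, hy,
      smul_smul (L0.ind P Bᶜ _), hsub, smul_zero, add_zero, smul_add]
    abel
  -- On `Aᶜ \ B`, where `y = 0`, maximality of `B` lets `W` itself avoid `D`, against maximality of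
  -- `A`.
  refine hCB (measure_mono_null (fun ω hω => (⟨hω, hω.1⟩ : ω ∈ (Aᶜ \ B) \ A)) (hmax _
    (hA.compl.diff hB) ⟨W, hW, fun C hC hCs v hv e he hve => ?_⟩))
  refine measure_mono_null (fun ω hω => (⟨hω, (hCs hω).2⟩ : ω ∈ C \ B))
    (hBmax C hC ⟨v, hv, e, he, ?_⟩)
  intro C' hC' hCC
  rw [smul_add, hy0 _ _ ((hCC.trans hCs).trans sdiff_subset), zero_add]
  exact ind_smul_congr_of_subset _ hC hCC hve

end Concatenation

/-! ### Closed differences, gauges and separation from a neighbourhood -/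

section Separation

variable {Ω : Type u} [MeasurableSpace Ω] {P : Measure Ω} {E : Type v} [AddCommGroup E]
  [Module (L0 P) E]

open scoped Pointwise

theorem IsConcat.add {A : AEPartition P} {x y : ℕ → E} {z w : E} (hx : IsConcat A x z)
    (hy : IsConcat A y w) : IsConcat A (fun k => x k + y k) (z + w) := fun k => by
  rw [smul_add, smul_add, hx, hy]

theorem IsConcat.sub {A : AEPartition P} {x y : ℕ → E} {z w : E} (hx : IsConcat A x z)
    (hy : IsConcat A y w) : IsConcat A (fun k => x k - y k) (z - w) := fun k => by
  rw [smul_sub, smul_sub, hx, hy]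

theorem IsStable.sub (hE : HasCountableConcat P E) {S T : Set E} (hS : IsStable P S)
    (hT : IsStable P T) : IsStable P (S - T) := by
  refine ⟨hS.1.sub hT.1, fun A x hx z hz => ?_⟩
  choose s hs t ht hst using fun k => mem_sub.1 (hx k)
  obtain ⟨a, ha, -⟩ := hE A s
  obtain ⟨b, hb, -⟩ := hE A t
  refine mem_sub.2 ⟨a, hS.2 A s hs a ha, b, hT.2 A t ht b hb, (hE A x).unique ?_ hz⟩
  simpa only [hst] using ha.sub hb

theorem IsL0Convex.sub {S T : Set E} (hS : IsL0Convex P S) (hT : IsL0Convex P T) :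
    IsL0Convex P (S - T) := by
  rintro _ ⟨s, hs, t, ht, rfl⟩ _ ⟨s', hs', t', ht', rfl⟩ η h0 h1
  refine mem_sub.2 ⟨_, hS s hs s' hs' η h0 h1, _, hT t ht t' ht' η h0 h1, ?_⟩
  rw [smul_sub, smul_sub]
  abel

theorem IsL0Convex.add_singleton {S : Set E} (hS : IsL0Convex P S) (y : E) :
    IsL0Convex P (S + {y}) := by
  rintro _ ⟨s, hs, _, rfl, rfl⟩ _ ⟨s', hs', _, rfl, rfl⟩ η h0 h1
  refine mem_add.2 ⟨_, hS s hs s' hs' η h0 h1, _, rfl, ?_⟩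
  rw [smul_add, smul_add, sub_smul, sub_smul, one_smul, one_smul]
  abel

/-- The gauge of an `L⁰`-convex `L⁰`-absorbing set. -/
theorem exists_isL0Sublinear_isGLB [IsFiniteMeasure P] {K : Set E} (hK : IsL0Convex P K)
    (hKa : IsL0Absorbing P K) :
    ∃ p : E → L0 P, IsL0Sublinear p ∧
      ∀ x, IsGLB {η | L0.StrictLT 0 η ∧ ∃ k ∈ K, x = η • k} (p x) := by
  have hS : ∀ x, ∃ h, IsGLB {η : L0 P | L0.StrictLT 0 η ∧ ∃ k ∈ K, x = η • k} h :=
    fun x => L0.exists_isGLB (hKa x) ⟨0, fun η hη => hη.1.le⟩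
  choose p hp using hS
  refine ⟨p, isL0Sublinear_of_isGLB hp ?_ ?_, hp⟩
  · rintro x y s ⟨hs, k, hk, rfl⟩ t ⟨ht, l, hl, rfl⟩
    -- `s k + t l` is `s + t` times the convex combination of `k` and `l` with weight `s / (s + t)`
    -- on `k`.
    obtain ⟨c, hc, hcst⟩ := (hs.add ht).exists_inv
    have h1 : c * s ≤ 1 := by
      rw [← hcst, mul_comm (s + t)]
      exact L0.mul_le_mul_of_nonneg hc.le (le_add_of_nonneg_right ht.le)
    refine ⟨s + t, ⟨hs.add ht, _, hK k hk l hl (c * s) (hc.mul hs).le h1, ?_⟩, le_rfl⟩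
    have e1 : (s + t) * (c * s) = s := by rw [← mul_assoc, hcst, one_mul]
    have e2 : (s + t) * (1 - c * s) = t := by rw [mul_sub, e1]; ring
    rw [smul_add, smul_smul, smul_smul, e1, e2]
  · rintro a ha x s ⟨hs, k, hk, rfl⟩
    exact ⟨a * s, ⟨ha.mul hs, k, hk, (mul_smul _ _ _).symm⟩, le_rfl⟩

variable [TopologicalSpace E]

/-- For `z` in the closure, the sets `S ∩ (z + T + V)`, with `V` in the base, form a stable filter
base on `S`. A cluster point `x` satisfies `x - z ∈ closure T = T`. -/
theorem IsStableLocallyL0Convex.isClosed_sub (hE : IsStableLocallyL0Convex P E) {S T : Set E}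
    (hS : IsStablyCompact P S) (hT : IsStable P T) (hTc : IsClosed T) : IsClosed (S - T) := by
  obtain ⟨hadd, -, hcc, U, hU, hUs, hUp⟩ := hE
  have htrans : ∀ x, ∀ V ∈ U, {w | w - x ∈ V} ∈ 𝓝 x := fun x V hV => by
    have hc : ContinuousAt (fun w : E => w + -x) x :=
      (hadd.comp (Continuous.prodMk_left (-x))).continuousAt
    have := hc.preimage_mem_nhds (t := V) (by simpa using hU.mem_of_mem hV)
    simpa only [preimage, ← sub_eq_add_neg] using this
  refine isClosed_of_closure_subset fun z hz => ?_
  set B : Set E → Set E := fun V => {x ∈ S | ∃ t ∈ T, ∃ v ∈ V, x = z + t + v}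
  have hBne : ∀ V ∈ U, (B V).Nonempty := by
    intro V hV
    obtain ⟨_, hw, s, hs, t, ht, rfl⟩ := mem_closure_iff_nhds.1 hz _ (htrans z V hV)
    exact ⟨s, hs, t, ht, s - t - z, hw, by abel⟩
  have hBconcat : ∀ (A : AEPartition P) (V : ℕ → Set E),
      concatSet A (fun k => B (V k)) ⊆ B (concatSet A V) := by
    rintro A V w ⟨x, hx, hxw⟩
    choose hxS t ht v hv hxtv using hx
    obtain ⟨t', ht', -⟩ := hcc A t
    obtain ⟨v', hv', -⟩ := hcc A v
    refine ⟨hS.1.2 A x hxS w hxw, t', hT.2 A t ht t' ht', v', ⟨v, hv, hv'⟩,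
      (hcc A x).unique hxw ?_⟩
    have hz' : IsConcat A (fun _ => z) z := fun _ => rfl
    simpa only [← hxtv] using (hz'.add ht').add hv'
  have hBmono : ∀ V W, V ⊆ W → B V ⊆ B W := fun V W h x ⟨hx, t, ht, v, hv, e⟩ =>
    ⟨hx, t, ht, v, h hv, e⟩
  have hBstable : IsStableCollection P (B '' U) := by
    refine ⟨hUs.1.image _, ?_, ?_⟩
    · rintro _ ⟨V, hV, rfl⟩
      refine ⟨hBne V hV, fun A x hx w hw => hBmono _ _ ?_ (hBconcat A (fun _ => V) ⟨x, hx, hw⟩)⟩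
      rintro v ⟨v', hv', hvv⟩
      exact (hUs.2.1 V hV).2 A v' hv' v hvv
    · intro A F hF
      choose V hV hVF using hF
      obtain rfl : (fun k => B (V k)) = F := funext hVF
      refine ⟨_, hUs.2.2 A V hV, Subset.antisymm ?_ (hBconcat A V)⟩
      rintro x ⟨hxS, t, ht, v, ⟨v', hv', hvv⟩, rfl⟩
      choose b hb using fun k => hBne (V k) (hV k)
      -- The `k`-th term need only agree with the given point on the `k`-th part; off it, an
      -- arbitrary point of `B (V k)` keeps the term in `B (V k)`.
      refine ⟨fun k => L0.ind P (A.part k) (A.measurable k) • (z + t + v) +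
        L0.ind P (A.part k)ᶜ (A.measurable k).compl • b k, fun k => ?_, fun k =>
        (ind_smul_glue_left _ _ Subset.rfl _ _).symm⟩
      obtain ⟨hbS, s, hs, u, hu, hbsu⟩ := hb k
      refine ⟨hS.1.glue_mem _ hxS hbS, _, hT.glue_mem (A.measurable k) ht hs, _,
        (hUs.2.1 _ (hV k)).glue_mem (A.measurable k) (hv' k) hu, ?_⟩
      have hvk : L0.ind P (A.part k) (A.measurable k) • v =
        L0.ind P (A.part k) (A.measurable k) • v' k := hvv k
      have hz1 : z = L0.ind P (A.part k) (A.measurable k) • z +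
          L0.ind P (A.part k)ᶜ (A.measurable k).compl • z := by
        rw [← add_smul, L0.ind_add_ind_compl, one_smul]
      beta_reduce
      rw [← hvk, hbsu, smul_add, smul_add, smul_add, smul_add]
      conv_rhs => rw [hz1]
      abel
  obtain ⟨x, hxS, hx⟩ := hS.2 (B '' U) ⟨hBstable, by rintro _ ⟨V, -, rfl⟩ x hx; exact hx.1, by
    rintro _ ⟨V, hV, rfl⟩ _ ⟨W, hW, rfl⟩
    obtain ⟨X, hX, hXVW⟩ := hU.mem_iff.1 (inter_mem (hU.mem_of_mem hV) (hU.mem_of_mem hW))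
    exact ⟨_, ⟨X, hX, rfl⟩, subset_inter (hBmono _ _ (hXVW.trans inter_subset_left))
      (hBmono _ _ (hXVW.trans inter_subset_right))⟩⟩
  refine mem_sub.2 ⟨x, hxS, x - z, ?_, by abel⟩
  refine hTc.closure_subset (mem_closure_iff_nhds.2 fun N hN => ?_)
  have hc : ContinuousAt (fun q : E × E => (x - z) + (q.1 + q.2)) (0, 0) :=
    (hadd.comp ((Continuous.prodMk_right (x - z)).comp hadd)).continuousAt
  have hmem := hc.preimage_mem_nhds (t := N) (by simpa using hN)
  rw [nhds_prod_eq] at hmem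
  -- For `b = z + t + v` with `b - x` and `v` in `W`, `t = (x - z) + (b - x) + (-v)`, and
  -- balancedness gives `-v ∈ W`.
  obtain ⟨W, hW, hWN⟩ := hU.prod_self.mem_iff.1 hmem
  obtain ⟨b, hbx, hbS, t, ht, v, hv, rfl⟩ :=
    mem_closure_iff_nhds.1 (hx _ ⟨W, hW, rfl⟩) _ (htrans x W hW)
  have hnv : -v ∈ W := by
    have := (hUp W hW).2.2 v hv (-1) (by
      rw [abs_neg, abs_of_nonneg L0.zero_strictLT_one.le])
    simpa using this
  refine ⟨t, ?_, ht⟩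
  have h : (x - z) + ((z + t + v - x) + -v) ∈ N := hWN (mk_mem_prod hbx hnv)
  rwa [show (x - z) + ((z + t + v - x) + -v) = t by abel] at h

/-- An `L⁰`-linear map bounded by `1` on a neighbourhood of `0` is continuous. -/
theorem IsStableLocallyL0Convex.continuous_of_abs_le (hE : IsStableLocallyL0Convex P E)
    (f : E →ₗ[L0 P] L0 P) {V : Set E} (hV : V ∈ 𝓝 0) (hf : ∀ v ∈ V, |f v| ≤ 1) :
    Continuous f := by
  refine continuous_def.2 fun s hs => isOpen_iff_mem_nhds.2 fun x hx => ?_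
  obtain ⟨ε, hε, h⟩ := hs (f x) hx
  obtain ⟨δ, hδ, hεδ⟩ := hε.exists_inv
  have hc : Continuous fun w : E => δ • (w + -x) :=
    hE.continuous_smul.comp ((Continuous.prodMk_right δ).comp
      (hE.continuous_add.comp (Continuous.prodMk_left (-x))))
  filter_upwards [hc.continuousAt.preimage_mem_nhds (x := x) (t := V) (by simpa using hV)]
    with w hw
  refine h _ ?_
  have := L0.abs_mul_le hε.le (hf _ hw)
  rwa [map_smul, smul_eq_mul, ← mul_assoc, hεδ, one_mul, mul_one, ← sub_eq_add_neg, map_sub]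
    at this

/-- An `L⁰`-convex set which on no event meets a given neighbourhood of `0` is bounded away from
`0` by a continuous `L⁰`-linear map. -/
theorem IsStableLocallyL0Convex.exists_continuous_linearMap_le [IsFiniteMeasure P]
    (hE : IsStableLocallyL0Convex P E) {V D : Set E} (hV : V ∈ 𝓝 0) (hVc : IsL0Convex P V)
    (hVa : IsL0Absorbing P V) (hVb : IsL0Balanced P V) (hDne : D.Nonempty)
    (hDc : IsL0Convex P D)
    (hVD : ∀ A (hA : MeasurableSet A), ∀ v ∈ V, ∀ d ∈ D,
      L0.ind P A hA • v = L0.ind P A hA • d → P A = 0) :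
    ∃ (f : E →L[L0 P] L0 P) (δ : L0 P), L0.StrictLT 0 δ ∧ ∀ d ∈ D, δ ≤ f d := by
  obtain ⟨d₀, hd₀⟩ := hDne
  -- The translation by `d₀` gives `V ⊆ K`, so `K` is absorbing.
  set K : Set E := V - D + {d₀} 
  have hK : IsL0Convex P K := (hVc.sub hDc).add_singleton d₀
  have hVK : V ⊆ K := fun v hv => mem_add.2 ⟨v - d₀, sub_mem_sub hv hd₀, d₀, rfl, by abel⟩
  have hKa : IsL0Absorbing P K := fun x => by
    obtain ⟨η, hη, y, hy, e⟩ := hVa x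
    exact ⟨η, hη, y, hVK hy, e⟩
  obtain ⟨p, hp, hpK⟩ := exists_isL0Sublinear_isGLB hK hKa
  have hp1 : ∀ k ∈ K, p k ≤ 1 := fun k hk =>
    (hpK k).1 ⟨L0.zero_strictLT_one, k, hk, (one_smul _ _).symm⟩
  have hpd : 1 ≤ p d₀ := by
    refine (hpK d₀).2 ?_
    rintro η ⟨hη, k, hk, hdk⟩
    have hA := L0.measurableSet_lt η 1
    suffices hnull : P {ω | η ω < 1} = 0 by
      rw [← AEEqFun.coeFn_le]
      filter_upwards [measure_eq_zero_iff_ae_notMem.1 hnull,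
        AEEqFun.coeFn_one (μ := P) (β := ℝ)] with ω h1 h2
      rw [h2]
      exact not_lt.1 h1
    -- Truncation keeps the point in `K` and changes nothing on `{η < 1}`. There `d₀ = v - d + d₀`,
    -- so `v = d` and the event is null.
    have hk' : (η ⊓ 1) • k ∈ K := by
      have := hK k hk 0 (hVK (mem_of_mem_nhds hV)) (η ⊓ 1)
        (le_inf hη.le L0.zero_strictLT_one.le) inf_le_right
      rwa [smul_zero, add_zero] at this
    obtain ⟨_, ⟨v, hv, d, hd, rfl⟩, _, rfl, e⟩ := hk'
    refine hVD _ hA v hv d hd ?_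
    have hη1 : L0.ind P _ hA * η = L0.ind P _ hA * (η ⊓ 1) := by
      apply AEEqFun.ext
      filter_upwards [AEEqFun.coeFn_mul (L0.ind P _ hA) η, L0.coeFn_ind (P := P) hA,
        AEEqFun.coeFn_mul (L0.ind P _ hA) (η ⊓ 1), AEEqFun.coeFn_inf η 1,
        AEEqFun.coeFn_one (μ := P) (β := ℝ)] with ω h1 h2 h3 h4 h5
      rw [h1, h3, Pi.mul_apply, Pi.mul_apply, h2, h4, h5]
      by_cases h : η ω < 1
      · simp [h.le]
      · simp [h]
    have h := congrArg (L0.ind P _ hA • ·) hdk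
    simp only [smul_smul] at h
    rw [hη1, mul_smul, ← e] at h
    simp only [smul_add, smul_sub] at h ⊢
    rwa [right_eq_add, sub_eq_zero] at h
  obtain ⟨f, hfp, hfd⟩ := hp.exists_linearMap_le_eq d₀
  have hfK : ∀ k ∈ K, f k ≤ 1 := fun k hk => (hfp k).trans (hp1 k hk)
  have hfd1 : 1 ≤ f d₀ := hpd.trans hfd
  have hcont : Continuous f := hE.continuous_of_abs_le f hV fun v hv => by
    have hnv := hVb v hv (-1) (by rw [abs_neg, abs_of_nonneg L0.zero_strictLT_one.le])
    rw [neg_smul, one_smul] at hnv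
    rw [abs_le', ← map_neg]
    exact ⟨hfK v (hVK hv), hfK _ (hVK hnv)⟩
  -- With `d₀ = η v`, `1 ≤ f d₀` gives `f v ≥ δ = η⁻¹`; then `f (v - d + d₀) ≤ 1 ≤ f d₀` gives `f v
  -- ≤ f d`.
  obtain ⟨η, hη, v, hv, hdv⟩ := hVa d₀
  obtain ⟨δ, hδ, hηδ⟩ := hη.exists_inv
  refine ⟨⟨f, hcont⟩, δ, hδ, fun d hd => ?_⟩
  have h1 : δ ≤ f v := by
    rw [hdv, map_smul, smul_eq_mul] at hfd1
    have := L0.mul_le_mul_of_nonneg hδ.le hfd1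
    rwa [mul_one, ← mul_assoc, mul_comm δ, hηδ, one_mul] at this
  refine h1.trans ?_
  have h2 := (hfK _ (mem_add.2 ⟨_, sub_mem_sub hv hd, d₀, rfl, rfl⟩)).trans hfd1
  rwa [map_add, map_sub, add_le_iff_nonpos_left, sub_nonpos] at h2

end Separation

/-! ### The separation theorem -/

open scoped Pointwise in
theorem mainTheorem4 {Ω : Type u} [MeasurableSpace Ω] (P : Measure Ω) [IsProbabilityMeasure P]
    {E : Type v} [AddCommGroup E] [Module (L0 P) E] [TopologicalSpace E]
    (hE : IsStableLocallyL0Convex P E)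
    (S₁ S₂ : Set E)
    (hS₁ : IsStable P S₁) (hS₂ : IsStable P S₂)
    (hS₁_convex : IsL0Convex P S₁) (hS₂_convex : IsL0Convex P S₂)
    (hS₁_compact : IsStablyCompact P S₁) (hS₂_closed : IsClosed S₂)
    (hdisj : ∀ (A : Set Ω) (hA : MeasurableSet A), P A ≠ 0 →
      ((fun x : E => L0.ind P A hA • x) '' S₁) ∩ ((fun x : E => L0.ind P A hA • x) '' S₂) = ∅) :
    ∃ (μ : E →L[L0 P] L0 P) (ε : L0 P), L0.StrictLT 0 ε ∧
      ∀ x ∈ S₁, ∀ y ∈ S₂, L0.StrictLT (μ y + ε) (μ x) := by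
  have hD := hS₁.sub hE.concat hS₂
  have hDc := hE.isClosed_sub hS₁_compact hS₂ hS₂_closed
  obtain ⟨U, hU, hUs, hUp⟩ := hE.exists_base
  obtain ⟨V, hV, hVD⟩ := hE.exists_nhds_ind_smul_ne hU hUs hD hDc (by
    rintro A hA _ ⟨x, hx, y, hy, rfl⟩ h
    by_contra hPA
    rw [smul_sub, sub_eq_zero] at h
    exact eq_empty_iff_forall_notMem.1 (hdisj A hA hPA) _ ⟨⟨x, hx, rfl⟩, y, hy, h.symm⟩)
  obtain ⟨hVc, hVa, hVb⟩ := hUp V hV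
  obtain ⟨f, δ, hδ, hf⟩ := hE.exists_continuous_linearMap_le (hU.mem_of_mem hV) hVc hVa hVb hD.1
    (hS₁_convex.sub hS₂_convex) hVD
  -- `δ` gives only a weak inequality; a strictly smaller `ε` makes it strict almost surely.
  obtain ⟨ε, hε, hεδ⟩ := hδ.exists_half
  refine ⟨f, ε, hε, fun x hx y hy => ?_⟩
  have h := hf _ (sub_mem_sub hx hy)
  rw [map_sub, le_sub_iff_add_le', ← AEEqFun.coeFn_le] at h
  filter_upwards [h, hεδ, AEEqFun.coeFn_add (f y) δ, AEEqFun.coeFn_add (f y) ε]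
    with ω h1 h2 h3 h4
  rw [h3, Pi.add_apply] at h1
  rw [h4, Pi.add_apply]
  linarith
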